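/- \textbf{Language.} Fix a set of constants with a finite subset $\mathcal{F}_P$ (the program constants, which form the Herbrand universe $\mathcal{H}_P$), variables, and predicates with arities. Atoms are $p(t_1,\dots,t_k)$ with each $t_i$ a program constant or a variable; $\mathcal{B}_P$ is the set of ground atoms, and an interpretation is a set $I\subseteq\mathcal{B}_P$. An intensional set $\{X\mid p(Y_1,\dots,Y_k)\}$ has the single local variable $X$, which occurs in the atom; an intensional multiset $\{\!\!\{X\mid\exists Z_1,\dots,Z_r.\,p(Y_1,\dots,Y_k)\}\!\!\}$ has exactly the local variables $X,Z_1,\dots,Z_r$ (pairwise distinct), which all occur in the atom. For a ground intensional set (resp. multiset) $s$, its value $s^I$ is the finite set of all $b\in\mathcal{H}_P$ such that the instance of the atom with $X=b$ is in $I$ (resp. the finite multiset in which each $b$ occurs once for every assignment of elements of $\mathcal{H}_P$ to $Z_1,\dots,Z_r$ that, together with $X=b$, gives an atom in $I$). Aggregate atoms are $q(f(s))$; the aggregate functions $f$ map finite sets and finite multisets over $\mathcal{H}_P$ to constants, the aggregate predicates $q$ are predicates on constants, and both have a fixed, arbitrary interpretation. $I\models q(f(s))$ means that $q(f(s^I))$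 is true. A program $P$ is an arbitrary set of rules \[A_0\leftarrow C_1,\dots,C_m,A_1,\dots,A_n,\,not\,B_1,\dots,not\,B_k\qquad(m,n,k\ge 0)\] with aggregate atoms $C_i$ and atoms $A_i,B_i$; $ground(P)$ is the set of its ground instances over $\mathcal{F}_P$ (local variables are not instantiated). \textbf{Answer sets.} For a ground aggregate atom $\ell$ whose set or multiset collects the predicate $p$, let $\mathcal{H}(\ell)\subseteq\mathcal{B}_P$ be the set of all ground atoms of $p$. A solution of $\ell$ is a pair $\langle S_1,S_2\rangle$ of disjoint subsets of $\mathcal{H}(\ell)$ such that $I\models\ell$ for every interpretation $I$ with $S_1\subseteq I$ and $S_2\cap I=\emptyset$. An unfolding of a ground rule as above is obtained by choosing a solution $\langle S_{i,1},S_{i,2}\rangle$ of each $C_i$ and taking the aggregate-free rule with head $A_0$, positive body $\{A_1,\dots,A_n\}\cup\bigcup_i S_{i,1}$ and negative body $\{B_1,\dots,B_k\}\cup\bigcup_i S_{i,2}$. Let $unfolding(P)$ be the set of all unfoldings of the rules in $ground(P)$. A set $A\subseteq\mathcal{B}_P$ is an $\mathbb{ASP}^A$-answer set of $P$ if it is an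 answer set of $unfolding(P)$, i.e. the least model of the Gelfond--Lifschitz reduct of $unfolding(P)$ with respect to $A$. \textbf{Exact stable models (Pelov, Denecker and Bruynooghe).} A three-valued interpretation is a pair $(I_1,I_2)$ with $I_1\subseteq I_2\subseteq\mathcal{B}_P$: atoms in $I_1$ are true, atoms outside $I_2$ are false, and all others are undefined. A ground aggregate atom $q(f(s))$ is evaluated in $(I_1,I_2)$ by its ultimate approximation: it is true if $q(f(z))$ holds for all sets (resp. multisets) $z$ with $s^{I_1}\subseteq z\subseteq s^{I_2}$, false if $q(f(z))$ holds for no such $z$, and undefined otherwise. Rule bodies are evaluated by the Kleene connectives. The operator $\Phi_P$ maps $(I_1,I_2)$ to the three-valued interpretation in which the value of a ground atom $a$ is the maximum, in the order false $<$ undefined $<$ true, of the values of the bodies of the rules in $ground(P)$ with head $a$ (false if there are none); write $\Phi_P=(\Phi_P^1,\Phi_P^2)$. The pair $(I_1,I_2)$ is a partial stable model of $P$ if $I_1$ is the least fixpoint of $\Phi_P^1(\cdot,I_2)$ among the subsets of $I_2$ and $I_2$ is the least fixpoint of $\Phi_P^2(I_1,\cdot)$ among the subsets of $\mathcal{B}_P$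 that contain $I_1$. A set $A\subseteq\mathcal{B}_P$ is an exact stable model of $P$ if $(A,A)$ is a partial stable model of $P$. \textbf{Theorem.} For every program $P$ with aggregates and every $A\subseteq\mathcal{B}_P$, $A$ is an $\mathbb{ASP}^A$-answer set of $P$ if and only if $A$ is an exact stable model of $P$. -/

import Mathlib

/-!
Logic programs with aggregates: syntax, grounding, aggregate solutions, unfolding and answer sets;
three-valued (ultimate) evaluation of aggregates, the three-valued immediate consequence
operator, and the partial and exact stable models obtained from it by approximation theory.
-/

universe u v w

namespace AggLP

/-! ### Signatures and the language -/

/-- A signature of the language together with a program signature over it: the constants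
`Const`, a finite set `progConst` of program constants, the aggregate functions and aggregate
predicates, the (free) variables, and the predicates of the program with their arities. The local
variables, whose scope is a single aggregate atom, are introduced in `SetTerm`. -/
structure Signature where
  Const : Type u
  progConst : Finset Const
  AggFun : Type u
  AggPred : Type u
  Var : Type u
  Pred : Type u
  arity : Pred → ℕ

/-- The Herbrand universe: the constants are the only ground terms. -/
abbrev Herbrand (S : Signature.{u}) : Type u := {c : S.Const // c ∈ S.progConst}

/-- The arguments of an atom: program constants or variables. -/
abbrev Term (S : Signature.{u}) : Type u := Herbrand S ⊕ S.Var

/-- Atoms `p(t₁, …, tₖ)` with arguments in `T`. -/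
structure Atom (S : Signature.{u}) (T : Type v) where
  pred : S.Pred
  args : Fin (S.arity pred) → T

/-- The ground atoms; this type is the Herbrand base, and an interpretation is a subset of it. -/
abbrev GroundAtom (S : Signature.{u}) : Type u := Atom S (Herbrand S)

/-- Intensional sets `{X | p(X₁, …, Xₖ)}` and multisets `{{X | ∃ Z₁ … Zᵣ. p(Y₁, …, Yₖ)}}`. An
argument is an element of `T` or a local variable. In a set, the one local variable `X` is
`Sum.inr ()`. In a multiset, `X` is `Sum.inr none` and `Zⱼ` is `Sum.inr (some j)`. The local
variables `X, Z₁, …, Zᵣ` all occur in the atom. -/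
inductive SetTerm (S : Signature.{u}) (T : Type v) where
  | set (p : S.Pred) (args : Fin (S.arity p) → T ⊕ Unit)
      (occurs : ∃ i, args i = Sum.inr ()) : SetTerm S T
  | multiset (p : S.Pred) (r : ℕ) (args : Fin (S.arity p) → T ⊕ Option (Fin r))
      (occurs : ∀ z, ∃ i, args i = Sum.inr z) : SetTerm S T

/-- Aggregate atoms `q(f(s))`. -/
structure AggAtom (S : Signature.{u}) (T : Type v) where
  aggPred : S.AggPred
  aggFun : S.AggFun
  term : SetTerm S T

/-- Rules `A ← C₁, …, Cₘ, A₁, …, Aₙ, not B₁, …, not Bₖ`: `agg` lists the aggregate atoms `Cᵢ`,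
`pos` the atoms `Aᵢ`, and `neg` the atoms `Bᵢ`. -/
structure Rule (S : Signature.{u}) (T : Type v) where
  head : Atom S T
  agg : List (AggAtom S T)
  pos : List (Atom S T)
  neg : List (Atom S T)

/-- Programs with aggregates. -/
abbrev Program (S : Signature.{u}) : Type u := Set (Rule S (Term S))

/-! ### Grounding -/

section Grounding

variable {S : Signature.{u}} {T : Type v} {T' : Type w}

/-- Replacement of the arguments of an atom. -/
def Atom.map (f : T → T') (a : Atom S T) : Atom S T' := ⟨a.pred, fun i => f (a.args i)⟩

/-- Replacement of the arguments that are not local variables. -/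
def SetTerm.map (f : T → T') : SetTerm S T → SetTerm S T'
  | .set p args occurs => .set p (fun i => Sum.map f id (args i))
      (by obtain ⟨i, hi⟩ := occurs; exact ⟨i, by simp [hi]⟩)
  | .multiset p r args occurs => .multiset p r (fun i => Sum.map f id (args i))
      (by intro z; obtain ⟨i, hi⟩ := occurs z; exact ⟨i, by simp [hi]⟩)

def AggAtom.map (f : T → T') (c : AggAtom S T) : AggAtom S T' :=
  ⟨c.aggPred, c.aggFun, c.term.map f⟩

def Rule.map (f : T → T') (r : Rule S T) : Rule S T' :=
  ⟨r.head.map f, r.agg.map (AggAtom.map f), r.pos.map (Atom.map f), r.neg.map (Atom.map f)⟩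

/-- A ground substitution `{X₁/a₁, …, Xₖ/aₖ}` as a partial map, applied to a term. -/
def substTerm (θ : S.Var → Option (Herbrand S)) : Term S → Term S
  | .inl c => .inl c
  | .inr x => (θ x).elim (.inr x) .inl

/-- `ground(P)`: the ground rules that are of the form `rθ` with `r ∈ P` and `θ` a ground
substitution. -/
def ground (P : Program S) : Set (Rule S (Herbrand S)) :=
  {g | ∃ r ∈ P, ∃ θ : S.Var → Option (Herbrand S), r.map (substTerm θ) = g.map Sum.inl}

end Grounding

/-! ### Two-valued evaluation of aggregates -/

/-- The values of intensional sets and multisets: finite sets and finite multisets over the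
Herbrand universe. Values of different kinds are incomparable in the order. -/
abbrev SetValue (S : Signature.{u}) : Type u := Finset (Herbrand S) ⊕ Multiset (Herbrand S)

/-- The fixed interpretation of the aggregate functions and aggregate predicates. -/
structure AggInterp (S : Signature.{u}) where
  aggFun : S.AggFun → SetValue S → S.Const
  aggPred : S.AggPred → S.Const → Prop

section Evaluation

variable {S : Signature.{u}}

open Classical in
/-- The value of an intensional set or multiset in an interpretation. In the multiset
`{{X | ∃ Z₁ … Zᵣ. q}}` every `a` occurs as often as there are values of `Z₁, …, Zᵣ` for which
the instance of `q` with `X = a` is true. -/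
noncomputable def SetTerm.eval (I : Set (GroundAtom S)) : SetTerm S (Herbrand S) → SetValue S
  | .set p args _ => .inl (Finset.univ.filter fun b : Herbrand S =>
      (⟨p, fun i => (args i).elim id fun _ => b⟩ : GroundAtom S) ∈ I)
  | .multiset p r args _ => .inr ((Finset.univ.filter fun η : Option (Fin r) → Herbrand S =>
      (⟨p, fun i => (args i).elim id η⟩ : GroundAtom S) ∈ I).val.map fun η => η none)

theorem SetTerm.eval_mono (s : SetTerm S (Herbrand S)) :
    Monotone fun I : Set (GroundAtom S) => s.eval I := by
  classical
  intro I J hIJ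
  cases s with
  | set p args h =>
    exact Sum.inl_le_inl_iff.2 (Finset.monotone_filter_right _ fun _ _ hb => hIJ hb)
  | multiset p r args h =>
    exact Sum.inr_le_inr_iff.2 (Multiset.map_le_map
      (Finset.val_le_iff.2 (Finset.monotone_filter_right _ fun _ _ hb => hIJ hb)))

/-- The relation `q(f(·))` on sets and multisets that belongs to an aggregate atom `q(f(s))`. -/
def AggAtom.rel {T : Type v} (F : AggInterp S) (c : AggAtom S T) (x : SetValue S) : Prop :=
  F.aggPred c.aggPred (F.aggFun c.aggFun x)

/-- `I ⊨ c` for a ground aggregate atom `c`. -/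
def AggAtom.Sat (F : AggInterp S) (I : Set (GroundAtom S)) (c : AggAtom S (Herbrand S)) : Prop :=
  c.rel F (c.term.eval I)

/-! ### Solutions, unfolding, answer sets -/

/-- The predicate of an intensional set or multiset. -/
def SetTerm.pred {T : Type v} : SetTerm S T → S.Pred
  | .set p _ _ => p
  | .multiset p _ _ _ => p

/-- `H(c)`: all ground atoms of the predicate that is collected in `c`. -/
def AggAtom.base (c : AggAtom S (Herbrand S)) : Set (GroundAtom S) :=
  {a | a.pred = c.term.pred}

/-- `⟨S₁, S₂⟩` is a solution of the ground aggregate atom `c`. -/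
structure IsSolution (F : AggInterp S) (c : AggAtom S (Herbrand S))
    (s : Set (GroundAtom S) × Set (GroundAtom S)) : Prop where
  fst_subset : s.1 ⊆ c.base
  snd_subset : s.2 ⊆ c.base
  disjoint : Disjoint s.1 s.2
  sat : ∀ I : Set (GroundAtom S), s.1 ⊆ I → s.2 ∩ I = ∅ → c.Sat F I

/-- Ground rules `head ← pos, not neg` without aggregates. -/
@[ext]
structure NormalRule (S : Signature.{u}) where
  head : GroundAtom S
  pos : Set (GroundAtom S)
  neg : Set (GroundAtom S)

/-- `I` is a model of a ground program without aggregates. -/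
def IsModel (Q : Set (NormalRule S)) (I : Set (GroundAtom S)) : Prop :=
  ∀ r ∈ Q, r.pos ⊆ I → r.neg ∩ I = ∅ → r.head ∈ I

/-- The Gelfond–Lifschitz reduct. -/
def reduct (Q : Set (NormalRule S)) (M : Set (GroundAtom S)) : Set (NormalRule S) :=
  {r' | ∃ r ∈ Q, r.neg ∩ M = ∅ ∧ r' = ⟨r.head, r.pos, ∅⟩}

/-- `M` is an answer set of `Q`: the least model of the reduct of `Q` with respect to `M`. -/
def IsAnswerSet (Q : Set (NormalRule S)) (M : Set (GroundAtom S)) : Prop :=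
  IsLeast {I | IsModel (reduct Q M) I} M

/-- The unfolding of a ground rule with respect to a sequence of pairs of sets of atoms. -/
def Rule.unfold (r : Rule S (Herbrand S))
    (s : Fin r.agg.length → Set (GroundAtom S) × Set (GroundAtom S)) : NormalRule S where
  head := r.head
  pos := {a | a ∈ r.pos} ∪ ⋃ i, (s i).1
  neg := {a | a ∈ r.neg} ∪ ⋃ i, (s i).2

/-- `unfolding(P)`: all unfoldings of the ground instances of the rules of `P` with respect to
sequences of solutions of their aggregate atoms. -/
def unfolding (F : AggInterp S) (P : Program S) : Set (NormalRule S) :=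
  {r' | ∃ r ∈ ground P, ∃ s : Fin r.agg.length → Set (GroundAtom S) × Set (GroundAtom S),
    (∀ i, IsSolution F (r.agg.get i) (s i)) ∧ r' = r.unfold s}

/-- `M` is an `ASP^A`-answer set of `P`. -/
def IsASPAAnswerSet (F : AggInterp S) (P : Program S) (M : Set (GroundAtom S)) : Prop :=
  IsAnswerSet (unfolding F P) M

end Evaluation

/-! ### Approximation theory

A consistent pair `(x, y)`, `x ≤ y`, of elements of `L` is an element of `NonemptyInterval L`; it
approximates the elements `z` with `x ≤ z ≤ y`, and it is exact if `x = y`. -/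

/-- `x` is a partial stable fixpoint of the operator `A` on consistent pairs: `x.fst` is the least
fixpoint of `A¹(·, x.snd)` on the elements below `x.snd`, and `x.snd` is the least fixpoint of
`A²(x.fst, ·)` on the elements above `x.fst`. -/
def IsPartialStable {L : Type v} [PartialOrder L]
    (A : NonemptyInterval L → NonemptyInterval L) (x : NonemptyInterval L) : Prop :=
  IsLeast {a | ∃ h : a ≤ x.snd, (A ⟨(a, x.snd), h⟩).fst = a} x.fst ∧
    IsLeast {b | ∃ h : x.fst ≤ b, (A ⟨(x.fst, b), h⟩).snd = b} x.snd

/-- The three truth values: `(True, True)` is true, `(False, True)` is undefined, and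
`(False, False)` is false. -/
abbrev TruthValue : Type := NonemptyInterval Prop

/-- Kleene negation. -/
def TruthValue.neg (v : TruthValue) : TruthValue :=
  ⟨(¬ v.snd, ¬ v.fst), fun h h' => h (v.fst_le_snd h')⟩

/-- Kleene conjunction: the minimum of a family of truth values in the order
false < undefined < true. -/
def TruthValue.all (V : Set TruthValue) : TruthValue :=
  ⟨(∀ v ∈ V, v.fst, ∀ v ∈ V, v.snd), fun h v hv => v.fst_le_snd (h v hv)⟩

/-- Kleene disjunction: the maximum of a family of truth values in the order
false < undefined < true. -/
def TruthValue.any (V : Set TruthValue) : TruthValue :=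
  ⟨(∃ v ∈ V, v.fst, ∃ v ∈ V, v.snd), fun ⟨v, hv, h⟩ => ⟨v, hv, v.fst_le_snd h⟩⟩

/-- The ultimate (most precise) approximation of a relation `R`: it is true on a consistent pair
if `R` holds for everything the pair approximates, false if `R` fails for everything the pair
approximates, and undefined otherwise. -/
def ultimate {L : Type v} [Preorder L] (R : L → Prop) (x : NonemptyInterval L) : TruthValue :=
  ⟨(∀ z ∈ x, R z, ∃ z ∈ x, R z), fun h => ⟨x.fst, ⟨le_rfl, x.fst_le_snd⟩, h _ ⟨le_rfl, x.fst_le_snd⟩⟩⟩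

/-! ### The three-valued semantics of programs with aggregates -/

section ThreeValued

variable {S : Signature.{u}}

/-- Three-valued interpretations: `(I₁, I₂)` with `I₁ ⊆ I₂`; the atoms of `I₁` are true, those
outside `I₂` are false, and the others are undefined. -/
abbrev Interp3 (S : Signature.{u}) : Type u := NonemptyInterval (Set (GroundAtom S))

/-- The truth value of a ground atom. -/
def Atom.eval3 (I : Interp3 S) (a : GroundAtom S) : TruthValue :=
  ⟨(a ∈ I.fst, a ∈ I.snd), fun h => I.fst_le_snd h⟩

/-- The three-valued set or multiset denoted by an intensional set or multiset: its certain and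
its possible elements. -/
noncomputable def SetTerm.eval3 (I : Interp3 S) (s : SetTerm S (Herbrand S)) :
    NonemptyInterval (SetValue S) :=
  I.map ⟨fun J => s.eval J, s.eval_mono⟩

/-- The truth value of a ground aggregate atom: the ultimate approximation of its aggregate
relation, applied to the three-valued set or multiset. -/
noncomputable def AggAtom.eval3 (F : AggInterp S) (I : Interp3 S) (c : AggAtom S (Herbrand S)) :
    TruthValue :=
  ultimate (c.rel F) (c.term.eval3 I)

/-- The truth value of the body of a ground rule: the conjunction of its elements. -/
noncomputable def Rule.bodyEval3 (F : AggInterp S) (I : Interp3 S) (r : Rule S (Herbrand S)) :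
    TruthValue :=
  TruthValue.all ({t | ∃ c ∈ r.agg, t = c.eval3 F I} ∪ {t | ∃ a ∈ r.pos, t = a.eval3 I} ∪
    {t | ∃ b ∈ r.neg, t = (b.eval3 I).neg})

/-- The value derived for a ground atom: the disjunction of the bodies of the rules of `ground P`
with that head. -/
noncomputable def derived (F : AggInterp S) (P : Program S) (I : Interp3 S) (a : GroundAtom S) :
    TruthValue :=
  TruthValue.any {t | ∃ r ∈ ground P, r.head = a ∧ t = r.bodyEval3 F I}

/-- The three-valued immediate consequence operator for programs with aggregates. -/
noncomputable def threeValuedTP (F : AggInterp S) (P : Program S) (I : Interp3 S) : Interp3 S :=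
  ⟨({a | (derived F P I a).fst}, {a | (derived F P I a).snd}),
    fun a h => (derived F P I a).fst_le_snd h⟩

/-- Partial stable models of a program with aggregates. -/
def IsPartialStableModel (F : AggInterp S) (P : Program S) (I : Interp3 S) : Prop :=
  IsPartialStable (threeValuedTP F P) I

/-- `A` is an exact stable model of `P`: the two-valued pair `(A, A)` is a partial stable
model. -/
def IsExactStableModel (F : AggInterp S) (P : Program S) (A : Set (GroundAtom S)) : Prop :=
  IsPartialStableModel F P (NonemptyInterval.pure A)

end ThreeValued

end AggLP

/-!
Fix the candidate `A`. For an arbitrary program `Q` without aggregates, `A` is an answer set of `Q`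
exactly when it is the least fixpoint of the monotone immediate consequence operator of the reduct
of `Q` with respect to `A` (`isAnswerSet_iff_lfp_eq`).

The heart of the argument is `AggAtom.eval3_fst_iff`: for `I ⊆ A`, the ultimate approximation of an
aggregate atom `c` is true in `(I, A)` if and only if `c` has a solution `⟨S₁, S₂⟩` with `S₁ ⊆ I`
and `S₂ ∩ A = ∅`. If it is true, then the atoms of `H(c)` in `I` and those outside `A` form such a
solution. Conversely, every finite set or multiset between the values of `s` in `I` and in `A` is
the value of `s` in some interpretation between `I` and `A` (`SetTerm.exists_eval_eq`), because
all local variables occur in the atom, so different assignments to them give different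
ground atoms.

Hence `Φ¹(·, A)` and the consequence operator of the reduct of the unfolding agree below `A`
(`threeValuedTP_fst_eq`). On exact pairs `Φ¹` and `Φ²` coincide (`threeValuedTP_snd_pure`), so the
condition on the upper bound of an exact stable model holds as soon as `A` is a fixpoint.
-/

namespace AggLP

variable {S : Signature.{u}}

/-! ### Answer sets as least fixpoints -/

/-- The immediate consequence operator of the Gelfond–Lifschitz reduct of `Q` with respect
to `M`. -/
def reductConsequences (Q : Set (NormalRule S)) (M : Set (GroundAtom S)) :
    Set (GroundAtom S) →o Set (GroundAtom S) where
  toFun I := {a | ∃ r ∈ Q, r.neg ∩ M = ∅ ∧ r.pos ⊆ I ∧ r.head = a}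
  monotone' := by
    rintro I J hIJ a ⟨r, hr, hneg, hpos, rfl⟩
    exact ⟨r, hr, hneg, hpos.trans hIJ, rfl⟩

theorem isModel_reduct_iff (Q : Set (NormalRule S)) (M I : Set (GroundAtom S)) :
    IsModel (reduct Q M) I ↔ reductConsequences Q M I ≤ I := by
  constructor
  · rintro h a ⟨r, hr, hneg, hpos, rfl⟩
    exact h ⟨r.head, r.pos, ∅⟩ ⟨r, hr, hneg, rfl⟩ hpos (Set.empty_inter _)
  · rintro h _ ⟨r, hr, hneg, rfl⟩ hpos -
    exact h ⟨r, hr, hneg, hpos, rfl⟩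

theorem isAnswerSet_iff_lfp_eq (Q : Set (NormalRule S)) (M : Set (GroundAtom S)) :
    IsAnswerSet Q M ↔ (reductConsequences Q M).lfp = M := by
  simp only [IsAnswerSet, isModel_reduct_iff]
  refine ⟨fun h => (OrderHom.isLeast_lfp_le _).unique h, fun h => ?_⟩
  have := (reductConsequences Q M).isLeast_lfp_le
  rwa [h] at this

/-! ### Interpolation of values of intensional sets and multisets -/

theorem exists_multiset_le_map_eq {α β : Type*} {f : α → β} {m : Multiset α} {y : Multiset β}
    (h : y ≤ m.map f) : ∃ x ≤ m, x.map f = y := by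
  induction m using Quotient.inductionOn with | _ m
  induction y using Quotient.inductionOn with | _ y
  obtain ⟨l, hl, hsub⟩ := h
  obtain ⟨k, hk, rfl⟩ := List.sublist_map_iff.1 hsub
  exact ⟨k, hk.subperm, Quotient.sound hl⟩

/-- A multiset between the images of two finite sets is the image of a finite set between them. -/
theorem exists_finset_map_eq {α β : Type*} {s t : Finset α} (f : α → β) (hst : s ⊆ t)
    {z : Multiset β} (hs : s.val.map f ≤ z) (ht : z ≤ t.val.map f) :
    ∃ w : Finset α, s ⊆ w ∧ w ⊆ t ∧ w.val.map f = z := by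
  classical
  obtain ⟨y, rfl⟩ := Multiset.le_iff_exists_add.1 hs
  have hy : y ≤ (t \ s).val.map f := by
    have h : t.val = s.val + (t \ s).val := by
      rw [Finset.sdiff_val, add_tsub_cancel_of_le (Finset.val_le_iff.2 hst)]
    rw [h, Multiset.map_add] at ht
    exact Multiset.add_le_add_iff_left.1 ht
  obtain ⟨x, hx, rfl⟩ := exists_multiset_le_map_eq hy
  have hx' : ∀ a ∈ x, a ∈ t ∧ a ∉ s := fun a ha =>
    Finset.mem_sdiff.1 (Multiset.mem_of_le hx ha :)
  refine ⟨s.disjUnion ⟨x, Multiset.nodup_of_le hx (t \ s).nodup⟩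
    (Finset.disjoint_right.2 fun a ha => (hx' a ha).2), ?_, ?_, Multiset.map_add _ _ _⟩
  · exact fun a ha => Finset.mem_disjUnion.2 (.inl ha)
  · exact fun a ha => (Finset.mem_disjUnion.1 ha).elim (fun h => hst h) fun h => (hx' a h).1

/-- Every value between those in `I` and in `J` is attained between `I` and `J`: as all local
variables occur in the atom, its instances can be made true independently of each other. -/
theorem SetTerm.exists_eval_eq (s : SetTerm S (Herbrand S)) {I J : Set (GroundAtom S)}
    (hIJ : I ⊆ J) {z : SetValue S} (hI : s.eval I ≤ z) (hJ : z ≤ s.eval J) :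
    ∃ K, I ⊆ K ∧ K ⊆ J ∧ s.eval K = z := by
  classical
  cases s with
  | set p args occurs =>
    obtain z | z := z
    swap
    · exact absurd hI Sum.not_inl_le_inr
    have hI := Sum.inl_le_inl_iff.1 hI
    have hJ := Sum.inl_le_inl_iff.1 hJ
    let g : Herbrand S → GroundAtom S := fun b => ⟨p, fun i => (args i).elim id fun _ => b⟩
    have hg : Function.Injective g := by
      intro b b' h
      obtain ⟨i, hi⟩ := occurs
      simpa [hi] using congrFun (eq_of_heq (Atom.mk.inj h).2) i
    refine ⟨I ∪ g '' z, Set.subset_union_left, Set.union_subset hIJ ?_, ?_⟩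
    · rintro _ ⟨b, hb, rfl⟩
      exact (Finset.mem_filter.1 (hJ hb)).2
    · refine congrArg Sum.inl (Finset.ext fun b => ?_)
      refine (@Finset.mem_filter _ _ (_) _ _).trans ?_
      constructor
      · rintro ⟨-, hb | hb⟩
        · exact hI (Finset.mem_filter.2 ⟨Finset.mem_univ _, hb⟩)
        · exact (hg.mem_set_image (s := (z : Set (Herbrand S)))).1 hb
      · exact fun hb => ⟨Finset.mem_univ _, Or.inr ⟨b, hb, rfl⟩⟩
  | multiset p r args occurs =>
    obtain z | z := z
    · exact absurd hI Sum.not_inr_le_inl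
    have hI := Sum.inr_le_inr_iff.1 hI
    have hJ := Sum.inr_le_inr_iff.1 hJ
    let g : (Option (Fin r) → Herbrand S) → GroundAtom S :=
      fun η => ⟨p, fun i => (args i).elim id η⟩
    have hg : Function.Injective g := by
      intro η η' h
      funext x
      obtain ⟨i, hi⟩ := occurs x
      simpa [hi] using congrFun (eq_of_heq (Atom.mk.inj h).2) i
    obtain ⟨w, hIw, hwJ, rfl⟩ := exists_finset_map_eq _
      (Finset.monotone_filter_right _ fun _ _ hb => hIJ hb) hI hJ
    refine ⟨I ∪ g '' w, Set.subset_union_left, Set.union_subset hIJ ?_, ?_⟩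
    · rintro _ ⟨η, hη, rfl⟩
      exact (Finset.mem_filter.1 (hwJ hη)).2
    · refine congrArg (fun v : Finset (Option (Fin r) → Herbrand S) =>
        (Sum.inr (v.val.map fun η => η none) : SetValue S)) (Finset.ext fun η => ?_)
      refine (@Finset.mem_filter _ _ (_) _ _).trans ?_
      constructor
      · rintro ⟨-, hη | hη⟩
        · exact hIw (Finset.mem_filter.2 ⟨Finset.mem_univ _, hη⟩)
        · exact (hg.mem_set_image (s := (w : Set (Option (Fin r) → Herbrand S)))).1 hη
      · exact fun hη => ⟨Finset.mem_univ _, Or.inr ⟨η, hη, rfl⟩⟩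

/-! ### Solutions and the ultimate approximation -/

/-- The value of an intensional set or multiset depends only on the atoms of its predicate. -/
theorem AggAtom.eval_le_eval (c : AggAtom S (Herbrand S)) {I J : Set (GroundAtom S)}
    (h : c.base ∩ I ⊆ J) : c.term.eval I ≤ c.term.eval J := by
  classical
  have key : c.term.eval I = c.term.eval (c.base ∩ I) := by
    unfold AggAtom.base
    cases c.term <;> simp [SetTerm.eval, SetTerm.pred]
  rw [key]
  exact c.term.eval_mono h

theorem AggAtom.eval3_fst_iff (F : AggInterp S) (c : AggAtom S (Herbrand S)) (I : Interp3 S) :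
    (c.eval3 F I).fst ↔ ∃ s, IsSolution F c s ∧ s.1 ⊆ I.fst ∧ s.2 ∩ I.snd = ∅ := by
  constructor
  · intro h
    refine ⟨(c.base ∩ I.fst, c.base \ I.snd), ⟨Set.inter_subset_left, Set.sdiff_subset, ?_, ?_⟩,
      Set.inter_subset_right, by simp⟩
    · exact Set.disjoint_left.2 fun a ha ha' => ha'.2 (I.fst_le_snd ha.2)
    · intro K h₁ h₂
      refine h _ ⟨c.eval_le_eval h₁, c.eval_le_eval fun a ha => ?_⟩
      by_contra hn
      exact Set.notMem_empty a (h₂ ▸ ⟨⟨ha.1, hn⟩, ha.2⟩)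
  · rintro ⟨s, hs, h₁, h₂⟩ z ⟨hz₁, hz₂⟩
    obtain ⟨K, hIK, hKJ, rfl⟩ := c.term.exists_eval_eq I.fst_le_snd hz₁ hz₂
    exact hs.sat K (h₁.trans hIK)
      (Set.subset_empty_iff.1 ((Set.inter_subset_inter_right _ hKJ).trans h₂.subset))

/-! ### The three-valued operator -/

theorem Rule.bodyEval3_fst_iff (F : AggInterp S) (I : Interp3 S) (r : Rule S (Herbrand S)) :
    (r.bodyEval3 F I).fst ↔ (∀ c ∈ r.agg, (c.eval3 F I).fst) ∧ (∀ a ∈ r.pos, a ∈ I.fst) ∧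
      ∀ b ∈ r.neg, b ∉ I.snd := by
  constructor
  · intro h
    exact ⟨fun c hc => h _ (.inl (.inl ⟨c, hc, rfl⟩)), fun a ha => h _ (.inl (.inr ⟨a, ha, rfl⟩)),
      fun b hb => h _ (.inr ⟨b, hb, rfl⟩)⟩
  · rintro ⟨h₁, h₂, h₃⟩ _ ((⟨c, hc, rfl⟩ | ⟨a, ha, rfl⟩) | ⟨b, hb, rfl⟩)
    exacts [h₁ c hc, h₂ a ha, h₃ b hb]

/-- The body of a ground rule is true exactly when some unfolding of the rule survives in the
reduct with respect to the upper bound and has its body satisfied by the lower bound. -/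
theorem Rule.bodyEval3_fst_iff_unfold (F : AggInterp S) (I : Interp3 S)
    (r : Rule S (Herbrand S)) :
    (r.bodyEval3 F I).fst ↔
      ∃ s : Fin r.agg.length → Set (GroundAtom S) × Set (GroundAtom S),
        (∀ i, IsSolution F (r.agg.get i) (s i)) ∧ (r.unfold s).neg ∩ I.snd = ∅ ∧
          (r.unfold s).pos ⊆ I.fst := by
  rw [Rule.bodyEval3_fst_iff, List.forall_mem_iff_get]
  simp only [AggAtom.eval3_fst_iff, Classical.skolem, Rule.unfold, Set.union_inter_distrib_right,
    Set.iUnion_inter, Set.union_empty_iff, Set.iUnion_eq_empty, Set.union_subset_iff,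
    Set.iUnion_subset_iff]
  have hneg : {a | a ∈ r.neg} ∩ I.snd = ∅ ↔ ∀ b ∈ r.neg, b ∉ I.snd := by
    simp [Set.eq_empty_iff_forall_notMem]
  rw [hneg]
  constructor
  · rintro ⟨⟨s, hs⟩, hp, hn⟩
    exact ⟨s, fun i => (hs i).1, ⟨hn, fun i => (hs i).2.2⟩, hp, fun i => (hs i).2.1⟩
  · rintro ⟨s, hs, ⟨hn, h₂⟩, hp, h₁⟩
    exact ⟨⟨s, fun i => ⟨hs i, h₁ i, h₂ i⟩⟩, hp, hn⟩

theorem threeValuedTP_fst_eq (F : AggInterp S) (P : Program S) (I : Interp3 S) :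
    (threeValuedTP F P I).fst = reductConsequences (unfolding F P) I.snd I.fst := by
  ext a
  constructor
  · rintro ⟨_, ⟨r, hr, rfl, rfl⟩, h⟩
    obtain ⟨s, hs, hn, hp⟩ := (Rule.bodyEval3_fst_iff_unfold F I r).1 h
    exact ⟨_, ⟨r, hr, s, hs, rfl⟩, hn, hp, rfl⟩
  · rintro ⟨_, ⟨r, hr, s, hs, rfl⟩, hn, hp, rfl⟩
    exact ⟨_, ⟨r, hr, rfl, rfl⟩, (Rule.bodyEval3_fst_iff_unfold F I r).2 ⟨s, hs, hn, hp⟩⟩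

theorem AggAtom.eval3_pure_snd_iff (F : AggInterp S) (c : AggAtom S (Herbrand S))
    (A : Set (GroundAtom S)) :
    (c.eval3 F (.pure A)).snd ↔ (c.eval3 F (.pure A)).fst := by
  -- the only value that an exact pair approximates is its common bound
  have hz : ∀ z ∈ c.term.eval3 (.pure A), z = c.term.eval A := fun z hz => le_antisymm hz.2 hz.1
  constructor
  · rintro ⟨z, hz', h⟩ y hy
    rw [hz y hy, ← hz z hz']
    exact h
  · exact (c.eval3 F (.pure A)).fst_le_snd

/-- Two-valued interpretations give two-valued bodies. -/
theorem Rule.bodyEval3_pure_snd_iff (F : AggInterp S) (A : Set (GroundAtom S))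
    (r : Rule S (Herbrand S)) :
    (r.bodyEval3 F (.pure A)).snd ↔ (r.bodyEval3 F (.pure A)).fst := by
  refine ⟨fun h => ?_, (r.bodyEval3 F (.pure A)).fst_le_snd⟩
  exact (Rule.bodyEval3_fst_iff F (.pure A) r).2
    ⟨fun c hc => (c.eval3_pure_snd_iff F A).1 (h _ (.inl (.inl ⟨c, hc, rfl⟩))),
      fun a ha => h _ (.inl (.inr ⟨a, ha, rfl⟩)), fun b hb => h _ (.inr ⟨b, hb, rfl⟩)⟩

theorem threeValuedTP_pure_snd (F : AggInterp S) (P : Program S) (A : Set (GroundAtom S)) :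
    (threeValuedTP F P (.pure A)).snd = (threeValuedTP F P (.pure A)).fst := by
  ext a
  constructor
  · rintro ⟨_, ⟨r, hr, rfl, rfl⟩, h⟩
    exact ⟨_, ⟨r, hr, rfl, rfl⟩, (r.bodyEval3_pure_snd_iff F A).1 h⟩
  · exact fun h => (threeValuedTP F P (.pure A)).fst_le_snd h

end AggLP

theorem mainTheorem3 (S : AggLP.Signature.{u}) (F : AggLP.AggInterp S) (P : AggLP.Program S)
    (A : Set (AggLP.GroundAtom S)) :
    AggLP.IsASPAAnswerSet F P A ↔ AggLP.IsExactStableModel F P A := by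
  rw [AggLP.IsASPAAnswerSet, AggLP.isAnswerSet_iff_lfp_eq]
  set T := AggLP.reductConsequences (AggLP.unfolding F P) A
  constructor
  · intro h
    have hA : T A = A := by
      have := T.map_lfp
      rwa [h] at this
    refine ⟨⟨⟨le_rfl, (AggLP.threeValuedTP_fst_eq F P _).trans hA⟩, ?_⟩,
      ⟨le_rfl, ?_⟩, fun b hb => hb.1⟩
    · rintro I ⟨hI, hfix⟩
      rw [AggLP.threeValuedTP_fst_eq] at hfix
      exact h.symm.le.trans (T.lfp_le_fixed hfix)
    · exact (AggLP.threeValuedTP_pure_snd F P A).trans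
        ((AggLP.threeValuedTP_fst_eq F P _).trans hA)
  · rintro ⟨⟨⟨_, hfix⟩, hleast⟩, -⟩
    have hA : T A = A := (AggLP.threeValuedTP_fst_eq F P _).symm.trans hfix
    have hle : T.lfp ≤ A := T.lfp_le_fixed hA
    exact le_antisymm hle
      (hleast ⟨hle, (AggLP.threeValuedTP_fst_eq F P _).trans T.map_lfp⟩)
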